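/- A translation surface is a pair $(S,\alpha)$ of a Riemann surface $S$ and a holomorphic $1$-form $\alpha$ on $S$ that is not identically zero. Away from the zeros of $\alpha$, the local coordinates $q\mapsto\int_p^q\alpha$ to $\mathbb{C}$ differ by translations; Lebesgue measure (area) on $(S,\alpha)$ is the pullback of planar Lebesgue measure under them (the zeros of $\alpha$ having measure $0$), and the translation flow $F^t$ is given in them by $(x,y)\mapsto(x+t,y)$. A Borel measure is called translation flow-invariant if for almost every point $F^t$ is defined for all $t\in\mathbb{R}$ (the trajectory neither meeting a zero of $\alpha$ nor leaving $S$ in finite time) and every $F^t$ preserves the measure. The translation flow is ergodic if Lebesgue measure is invariant and every measurable set $A$ with $F^{-t}(A)=A$ up to a null set for all $t$ is null or has null complement; it is uniquely ergodic if there is exactly one invariant Borel probability measure. **Corollary (Lifting unique ergodicity).** Let $(S,\alpha)$ be a connected translation surface of finite area and of infinite topological type (that is, $\pi_1(S)$ is not finitely generated). Let $p:\tilde S\to S$ be a finite (unbranched) covering of degree $d\ge 1$, and let $\tilde S$ carry the lifted structure, so that $p$ is holomorphic and $\tilde\alpha=p^*\alpha$. Suppose that the translation flows on $(S,\alpha)$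 and on $(\tilde S,\tilde\alpha)$ are both ergodic, and that the translation flow on $(S,\alpha)$ is uniquely ergodic. Then the translation flow on $(\tilde S,\tilde\alpha)$ is uniquely ergodic. -/

import Mathlib

open scoped Manifold ContDiff Topology
open MeasureTheory

noncomputable section

/-- A holomorphic 1-form on a Riemann surface `S`: a complex-linear functional on every tangent
space which in every chart `e` of the atlas reads `g(z) dz` with `g` holomorphic. -/
structure HolomorphicOneForm (S : Type*) [TopologicalSpace S] [ChartedSpace ℂ S] where
  toFun : ∀ x : S, TangentSpace 𝓘(ℂ) x →L[ℂ] ℂ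
  holomorphic : ∀ e ∈ atlas ℂ S,
    DifferentiableOn ℂ
      (fun z : ℂ => toFun (e.symm z) (mfderiv 𝓘(ℂ) 𝓘(ℂ) e.symm z (1 : ℂ))) e.target

/-- A connected surface is of infinite topological type if its fundamental group is not finitely
generated. -/
def InfiniteTopologicalType (S : Type*) [TopologicalSpace S] : Prop :=
  ∀ s : S, ¬ Group.FG (FundamentalGroup S s)

namespace HolomorphicOneForm

section

variable {S : Type*} [TopologicalSpace S] [ChartedSpace ℂ S]

/-- Translation charts of `(S, α)`: homeomorphisms `c` from an open subset of `S` onto an open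
subset of `ℂ` with `dc = α`, that is, locally `c q = c p + ∫_p^q α`. They cover exactly the
complement of the zeros of `α`. -/
def IsTranslationChart (α : HolomorphicOneForm S) (c : OpenPartialHomeomorph S ℂ) : Prop :=
  ∀ x ∈ c.source, HasMFDerivAt 𝓘(ℂ) 𝓘(ℂ) c x (α.toFun x)

/-- A curve defined for all times which avoids the zeros of `α` and moves to the right with unit
speed in translation charts: `c (γ t) = c (γ s) + (t - s)` for `t` near `s`. -/
def IsTrajectory (α : HolomorphicOneForm S) (γ : ℝ → S) : Prop :=
  Continuous γ ∧ (∀ s, α.toFun (γ s) ≠ 0) ∧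
    ∀ c : OpenPartialHomeomorph S ℂ, α.IsTranslationChart c → ∀ s : ℝ, γ s ∈ c.source →
      ∀ᶠ t in 𝓝 s, c (γ t) = c (γ s) + ((t - s : ℝ) : ℂ)

/-- The set of points whose horizontal trajectory is defined for all (positive and negative)
times. -/
def flowDomain (α : HolomorphicOneForm S) : Set S :=
  {x | ∃ γ : ℝ → S, α.IsTrajectory γ ∧ γ 0 = x}

open Classical in
/-- The translation flow `F^t`. Points outside `flowDomain` are left fixed; this convention plays no
role, because invariant measures are required to give no mass to these points. -/
def flow (α : HolomorphicOneForm S) (t : ℝ) (x : S) : S :=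
  if h : ∃ γ : ℝ → S, α.IsTrajectory γ ∧ γ 0 = x then h.choose t else x

variable [MeasurableSpace S]

/-- Lebesgue measure (area) of `(S, α)`: the smallest measure on `S` that dominates, for each
translation chart, Lebesgue measure of the plane transported to the domain of the chart. As
changes of translation charts are locally translations, it agrees with that transported measure on
the domain of each chart, and it gives no mass to the zeros of `α`. -/
def area (α : HolomorphicOneForm S) : Measure S :=
  ⨆ c : {c : OpenPartialHomeomorph S ℂ // α.IsTranslationChart c},
    (volume.restrict c.1.target).map c.1.symm

/-- A measure is invariant under the translation flow if the flow is defined for all times almost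
everywhere and each `F^t` preserves the measure. -/
def IsFlowInvariant (α : HolomorphicOneForm S) (μ : Measure S) : Prop :=
  (∀ᵐ x ∂μ, x ∈ α.flowDomain) ∧ ∀ t : ℝ, MeasurePreserving (α.flow t) μ μ

/-- The translation flow is ergodic (with respect to Lebesgue measure). -/
def IsFlowErgodic (α : HolomorphicOneForm S) : Prop :=
  α.IsFlowInvariant α.area ∧
    ∀ A : Set S, MeasurableSet A → (∀ t : ℝ, α.flow t ⁻¹' A =ᵐ[α.area] A) →
      α.area A = 0 ∨ α.area Aᶜ = 0

/-- The translation flow is uniquely ergodic: it has exactly one invariant Borel probability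
measure. -/
def IsFlowUniquelyErgodic (α : HolomorphicOneForm S) : Prop :=
  ∃! μ : Measure S, IsProbabilityMeasure μ ∧ α.IsFlowInvariant μ

end

end HolomorphicOneForm

/-- `p : (T, β) → (S, α)` is an (unbranched) covering of degree `d` of translation surfaces: a
holomorphic `d`-sheeted topological covering with `β = p^* α`. -/
structure IsTranslationCover {S T : Type*} [TopologicalSpace S] [ChartedSpace ℂ S]
    [TopologicalSpace T] [ChartedSpace ℂ T]
    (β : HolomorphicOneForm T) (α : HolomorphicOneForm S) (p : T → S) (d : ℕ) : Prop where
  isCoveringMap : IsCoveringMap p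
  degree : ∀ x : S, Nat.card (p ⁻¹' {x}) = d
  holomorphic : MDifferentiable 𝓘(ℂ) 𝓘(ℂ) p
  pullback : ∀ y : T, β.toFun y = (α.toFun (p y)).comp (mfderiv 𝓘(ℂ) 𝓘(ℂ) p y)

end

/-! Let `ν` be an invariant probability measure upstairs. The covering sends trajectories to
trajectories, so the image of `ν` is invariant downstairs, and unique ergodicity there forces it to
be normalized area. Since `p` is a local isomorphism of translation surfaces, a null set inside one
sheet has null image, so it lies in the preimage of a null set and is `ν`-null; countably many
sheets give `ν ≪ β.area`. The density of `ν` is then a flow-invariant function, constant by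
ergodicity upstairs, and `ν` is normalized area.

The carrying lemmas are `isFlowInvariant_map`, `absolutelyContinuous_area` and `exists_eq_smul`;
`area_univ_le` makes the total area upstairs finite. Area is a supremum over translation charts, so
comparing areas requires moving charts both ways through `p`, hence holomorphy of local inverses. -/

open Set Filter

/-! ### Holomorphic homeomorphisms of plane domains -/

/-- An injective holomorphic function has nowhere vanishing derivative. -/
theorem OpenPartialHomeomorph.deriv_ne_zero_of_differentiableOn (f : OpenPartialHomeomorph ℂ ℂ)
    (hf : DifferentiableOn ℂ f f.source) {z : ℂ} (hz : z ∈ f.source) : deriv f z ≠ 0 := by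
  have han : AnalyticOnNhd ℂ f f.source := hf.analyticOnNhd f.open_source
  have hsrc : ∀ᶠ w in 𝓝 z, w ∈ f.source := f.open_source.mem_nhds hz
  rcases (han z hz).deriv.eventually_eq_zero_or_eventually_ne_zero with h0 | hne
  · exfalso
    obtain ⟨r, hr, hball⟩ := Metric.eventually_nhds_iff_ball.1 (h0.and hsrc)
    have hconst : ∀ w ∈ Metric.ball z r, f w = f z := fun w hw =>
      (convex_ball z r).is_const_of_fderivWithin_eq_zero (𝕜 := ℂ)
        (fun x hx => ((hf x (hball x hx).2).differentiableAt
          (f.open_source.mem_nhds (hball x hx).2)).differentiableWithinAt)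
        (fun x hx => by
          rw [fderivWithin_of_isOpen Metric.isOpen_ball hx]
          ext
          simp [(hball x hx).1]) hw (Metric.mem_ball_self hr)
    have hmem : z + (r / 2 : ℝ) ∈ Metric.ball z r := by
      simp [abs_of_pos hr, hr]
    have := f.injOn (hball _ hmem).2 hz (hconst _ hmem)
    simp [hr.ne'] at this
  -- Zeros of the derivative are isolated here, so the inverse is holomorphic on a punctured
  -- neighbourhood of `f z` and continuous at `f z`. The singularity is removable, and the chain
  -- rule applies.
  · have htarget : f z ∈ f.target := f.map_source hz
    have hcont : ContinuousAt f.symm (f z) := f.symm.continuousAt htarget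
    have hpunct : ∀ᶠ w in 𝓝[≠] (f z), DifferentiableAt ℂ f.symm w := by
      have htend : Tendsto f.symm (𝓝[≠] (f z)) (𝓝[≠] z) := by
        refine tendsto_nhdsWithin_iff.2 ⟨?_, ?_⟩
        · have := hcont.tendsto
          rw [f.left_inv hz] at this
          exact this.mono_left nhdsWithin_le_nhds
        · filter_upwards [self_mem_nhdsWithin,
            nhdsWithin_le_nhds (f.open_target.mem_nhds htarget)] with w hw hwt hwz
          apply hw
          rw [mem_singleton_iff] at hwz ⊢
          rw [← hwz, f.right_inv hwt]
      filter_upwards [htend.eventually hne,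
        nhdsWithin_le_nhds (f.open_target.mem_nhds htarget)] with w hw hwt
      exact (f.hasDerivAt_symm hwt hw
        ((han _ (f.map_target hwt)).differentiableAt.hasDerivAt)).differentiableAt
    have hg : DifferentiableAt ℂ f.symm (f z) :=
      (Complex.analyticAt_of_differentiable_on_punctured_nhds_of_continuousAt
        hpunct hcont).differentiableAt
    have hcomp : HasDerivAt (f.symm ∘ f) (deriv f.symm (f z) * deriv f z) z :=
      hg.hasDerivAt.comp z (han z hz).differentiableAt.hasDerivAt
    have hid : HasDerivAt (f.symm ∘ f) 1 z :=
      (hasDerivAt_id z).congr_of_eventuallyEq (f.eventually_left_inverse hz)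
    intro h
    simpa [h] using hcomp.unique hid

theorem OpenPartialHomeomorph.differentiableAt_symm_of_differentiableOn
    (f : OpenPartialHomeomorph ℂ ℂ) (hf : DifferentiableOn ℂ f f.source) {w : ℂ}
    (hw : w ∈ f.target) : DifferentiableAt ℂ f.symm w :=
  (f.hasDerivAt_symm hw (f.deriv_ne_zero_of_differentiableOn hf (f.map_target hw))
    ((hf _ (f.map_target hw)).differentiableAt
      (f.open_source.mem_nhds (f.map_target hw))).hasDerivAt).differentiableAt

/-! ### Translation charts -/

section

variable {S T : Type*} [TopologicalSpace S] [ChartedSpace ℂ S]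
  [TopologicalSpace T] [ChartedSpace ℂ T]

/-- Translation charts pull back along local isomorphisms of translation surfaces. -/
theorem HolomorphicOneForm.IsTranslationChart.trans {α : HolomorphicOneForm S} {β : HolomorphicOneForm T}
    {c : OpenPartialHomeomorph S ℂ} (hc : α.IsTranslationChart c) {q : OpenPartialHomeomorph T S}
    (hq : ∀ y ∈ q.source, MDifferentiableAt 𝓘(ℂ) 𝓘(ℂ) q y)
    (hβ : ∀ y ∈ q.source, β.toFun y = (α.toFun (q y)).comp (mfderiv 𝓘(ℂ) 𝓘(ℂ) q y)) :
    β.IsTranslationChart (q.trans c) := by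
  intro y hy
  rw [OpenPartialHomeomorph.trans_source] at hy
  rw [hβ y hy.1]
  exact (hc _ hy.2).comp y (hq y hy.1).hasMFDerivAt

variable [IsManifold 𝓘(ℂ) ω S] [IsManifold 𝓘(ℂ) ω T]

/-- The inverse of a holomorphic homeomorphism between Riemann surfaces is holomorphic. -/
theorem OpenPartialHomeomorph.mdifferentiableAt_symm_of_mdifferentiableAt
    (q : OpenPartialHomeomorph T S)
    (hq : ∀ y ∈ q.source, MDifferentiableAt 𝓘(ℂ) 𝓘(ℂ) q y) {x : S} (hx : x ∈ q.target) :
    MDifferentiableAt 𝓘(ℂ) 𝓘(ℂ) q.symm x := by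
  have : IsManifold 𝓘(ℂ) 1 S := .of_le le_top
  have : IsManifold 𝓘(ℂ) 1 T := .of_le le_top
  set e := chartAt ℂ x
  set e' := chartAt ℂ (q.symm x)
  have he : e ∈ atlas ℂ S := chart_mem_atlas ℂ x
  have he' : e' ∈ atlas ℂ T := chart_mem_atlas ℂ _
  have hxe : x ∈ e.source := mem_chart_source ℂ x
  have hxe' : q.symm x ∈ e'.source := mem_chart_source ℂ _
  let f : OpenPartialHomeomorph ℂ ℂ := (e'.symm.trans q).trans e
  have hf : DifferentiableOn ℂ f f.source := by
    intro z hz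
    simp only [f, OpenPartialHomeomorph.trans_source, mem_inter_iff, mem_preimage,
      OpenPartialHomeomorph.symm_source, OpenPartialHomeomorph.coe_trans, Function.comp] at hz
    have h1 := mdifferentiableAt_atlas_symm (I := 𝓘(ℂ)) he' hz.1.1
    have h2 := hq _ hz.1.2
    have h3 := mdifferentiableAt_atlas (I := 𝓘(ℂ)) he hz.2
    exact ((h3.comp z (h2.comp z h1)).differentiableAt).differentiableWithinAt
  have hxt : e x ∈ f.target := by
    simp [f, hxe, hx, hxe']
  have hfs := (f.differentiableAt_symm_of_differentiableOn hf hxt).mdifferentiableAt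
  have hz : f.symm (e x) ∈ e'.target := by
    simp [f, hxe, hxe']
  have h := (mdifferentiableAt_atlas_symm (I := 𝓘(ℂ)) he' hz).comp x
    (hfs.comp x (mdifferentiableAt_atlas (I := 𝓘(ℂ)) he hxe))
  refine h.congr_of_eventuallyEq ?_
  have hcont : ContinuousAt q.symm x := q.symm.continuousAt hx
  filter_upwards [e.open_source.mem_nhds hxe, hcont.eventually (e'.open_source.mem_nhds hxe')]
    with w hw hw'
  simp [f, hw, e'.left_inv hw']

namespace HolomorphicOneForm

/-- The pullback relation between holomorphic one-forms can be inverted. -/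
theorem pullback_symm {α : HolomorphicOneForm S} {β : HolomorphicOneForm T}
    {q : OpenPartialHomeomorph T S}
    (hq : ∀ y ∈ q.source, MDifferentiableAt 𝓘(ℂ) 𝓘(ℂ) q y)
    (hβ : ∀ y ∈ q.source, β.toFun y = (α.toFun (q y)).comp (mfderiv 𝓘(ℂ) 𝓘(ℂ) q y))
    {x : S} (hx : x ∈ q.target) :
    α.toFun x = (β.toFun (q.symm x)).comp (mfderiv 𝓘(ℂ) 𝓘(ℂ) q.symm x) := by
  have hy := q.map_target hx
  have h1 := (q.mdifferentiableAt_symm_of_mdifferentiableAt hq hx).hasMFDerivAt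
  have h2 := (hq _ hy).hasMFDerivAt
  have hid : HasMFDerivAt 𝓘(ℂ) 𝓘(ℂ) (q ∘ q.symm) x (ContinuousLinearMap.id ℂ _) :=
    (hasMFDerivAt_id x).congr_of_eventuallyEq (q.eventually_right_inverse hx)
  have h3 := hasMFDerivAt_unique (h2.comp x h1) hid
  rw [hβ _ hy]
  have h4 : ∀ v : ℂ, (mfderiv 𝓘(ℂ) 𝓘(ℂ) q (q.symm x)) (mfderiv 𝓘(ℂ) 𝓘(ℂ) q.symm x v) = v :=
    fun v => DFunLike.congr_fun h3 v
  have hxx := q.right_inv hx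
  ext
  change (α.toFun x : ℂ →L[ℂ] ℂ) (1 : ℂ) = (α.toFun (q (q.symm x)) : ℂ →L[ℂ] ℂ)
    ((mfderiv 𝓘(ℂ) 𝓘(ℂ) q (q.symm x)) (mfderiv 𝓘(ℂ) 𝓘(ℂ) q.symm x (1 : ℂ)))
  rw [h4, hxx]

/-- Every point that is not a zero of `α` lies in the domain of a translation chart. -/
theorem exists_isTranslationChart (α : HolomorphicOneForm S) {x : S} (hx : α.toFun x ≠ 0) :
    ∃ c : OpenPartialHomeomorph S ℂ, α.IsTranslationChart c ∧ x ∈ c.source := by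
  have : IsManifold 𝓘(ℂ) 1 S := .of_le le_top
  set e := chartAt ℂ x
  have he : e ∈ atlas ℂ S := chart_mem_atlas ℂ x
  have hxe : x ∈ e.source := mem_chart_source ℂ x
  have hed : e.MDifferentiable 𝓘(ℂ) 𝓘(ℂ) := mdifferentiable_of_mem_atlas he
  let A : S → ℂ →L[ℂ] ℂ := α.toFun
  let D : S → ℂ →L[ℂ] ℂ := fun y => mfderiv 𝓘(ℂ) 𝓘(ℂ) e y
  let D' : ℂ → ℂ →L[ℂ] ℂ := fun z => mfderiv 𝓘(ℂ) 𝓘(ℂ) e.symm z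
  -- The tangent space is one-dimensional, so in the chart `e` the form is `g dz` with `g z = A
  -- (e.symm z) (D' z 1)`.
  have hform : ∀ y ∈ e.source, ∀ v : ℂ, A y v = A (e.symm (e y)) (D' (e y) 1) * D y v := by
    intro y hy v
    have h : D' (e y) (D y v) = v := DFunLike.congr_fun (hed.symm_comp_deriv hy) v
    have h' : v = D y v • D' (e y) 1 := by
      rw [← map_smul, smul_eq_mul, mul_one, h]
    rw [e.left_inv hy]
    conv_lhs => rw [h']
    rw [map_smul, smul_eq_mul, mul_comm]
  obtain ⟨r, hr, hball⟩ := Metric.isOpen_iff.1 e.open_target (e x) (e.map_source hxe)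
  -- On a disc `g` has a primitive `F`. As `g (e x) ≠ 0`, the inverse function theorem makes `F` a
  -- local homeomorphism, and `F ∘ e` is the chart.
  obtain ⟨F, hF⟩ : ∃ F : ℂ → ℂ, ∀ z ∈ Metric.ball (e x) r,
      HasDerivAt F (A (e.symm z) (D' z 1)) z :=
    ((α.holomorphic e he).mono hball).isExactOn_ball
  have hgx : A (e.symm (e x)) (D' (e x) 1) ≠ 0 := by
    intro h0
    apply hx
    ext
    have := hform x hxe 1
    rw [h0, zero_mul] at this
    exact this
  have hFan : AnalyticAt ℂ F (e x) :=
    DifferentiableOn.analyticAt (s := Metric.ball (e x) r)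
      (fun z hz => (hF z hz).differentiableAt.differentiableWithinAt) (Metric.ball_mem_nhds _ hr)
  have hstrict : HasStrictDerivAt F _ (e x) := hFan.hasStrictDerivAt
  rw [(hF _ (Metric.mem_ball_self hr)).deriv] at hstrict
  let H := (hstrict.hasStrictFDerivAt_equiv hgx).toOpenPartialHomeomorph F
  have hH : ⇑H = F := HasStrictFDerivAt.toOpenPartialHomeomorph_coe _
  have hxH : e x ∈ H.source := HasStrictFDerivAt.mem_toOpenPartialHomeomorph_source _
  refine ⟨e.trans (H.restrOpen (Metric.ball (e x) r) Metric.isOpen_ball), ?_, ?_⟩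
  · intro y hy
    simp only [OpenPartialHomeomorph.trans_source, OpenPartialHomeomorph.restrOpen_source,
      mem_inter_iff, mem_preimage] at hy
    have h1 := (hed.mdifferentiableAt hy.1).hasMFDerivAt
    have h2 := (hF (e y) hy.2.2).hasFDerivAt.hasMFDerivAt
    have h3 := h2.comp y h1
    have hfun : ⇑(e.trans (H.restrOpen (Metric.ball (e x) r) Metric.isOpen_ball)) = F ∘ e := by
      rw [← hH]; rfl
    have hα : (α.toFun y : ℂ →L[ℂ] ℂ) =
        (ContinuousLinearMap.toSpanSingleton ℂ (A (e.symm (e y)) (D' (e y) 1))).comp (D y) := by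
      ext
      exact (hform y hy.1 1).trans (mul_comm _ _)
    rw [hfun]
    exact hα ▸ h3
  · simp [hxe, hxH, hr]

end HolomorphicOneForm

end

/-! ### Trajectories and the flow -/

namespace HolomorphicOneForm

section

variable {S : Type*} [TopologicalSpace S] [ChartedSpace ℂ S] {α : HolomorphicOneForm S}

theorem flow_of_notMem {x : S} (hx : x ∉ α.flowDomain) (t : ℝ) : α.flow t x = x :=
  dif_neg hx

variable [T2Space S] [IsManifold 𝓘(ℂ) ω S]

/-- A trajectory is determined by its initial point. -/
theorem IsTrajectory.eq_of_apply_zero_eq {γ δ : ℝ → S} (hγ : α.IsTrajectory γ)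
    (hδ : α.IsTrajectory δ) (h0 : γ 0 = δ 0) : γ = δ := by
  have hclosed : IsClosed {t | γ t = δ t} := isClosed_eq hγ.1 hδ.1
  have hopen : IsOpen {t | γ t = δ t} := by
    refine isOpen_iff_mem_nhds.2 fun s hs => ?_
    obtain ⟨c, hc, hcs⟩ := α.exists_isTranslationChart (hγ.2.1 s)
    have hs' : γ s = δ s := hs
    have hcs' : δ s ∈ c.source := hs' ▸ hcs
    filter_upwards [hγ.2.2 c hc s hcs, hδ.2.2 c hc s hcs',
      hγ.1.continuousAt.eventually (c.open_source.mem_nhds hcs),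
      hδ.1.continuousAt.eventually (c.open_source.mem_nhds hcs')] with t h1 h2 h3 h4
    exact c.injOn h3 h4 (by rw [h1, h2, hs'])
  have huniv := IsClopen.eq_univ ⟨hclosed, hopen⟩ ⟨0, h0⟩
  funext t
  exact eq_univ_iff_forall.1 huniv t

/-- Uniqueness of trajectories makes the choice in `flow` immaterial. -/
theorem IsTrajectory.flow_eq {γ : ℝ → S} (hγ : α.IsTrajectory γ) (t : ℝ) :
    α.flow t (γ 0) = γ t := by
  have h : ∃ δ : ℝ → S, α.IsTrajectory δ ∧ δ 0 = γ 0 := ⟨γ, hγ, rfl⟩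
  rw [flow, dif_pos h]
  exact congrFun (h.choose_spec.1.eq_of_apply_zero_eq hγ h.choose_spec.2) t

/-- The flow moves every point of its domain, and fixes all other points. -/
theorem flowDomain_eq_iUnion (α : HolomorphicOneForm S) :
    α.flowDomain = ⋃ n : ℕ, {x | α.flow (1 / ((n : ℝ) + 1)) x = x}ᶜ := by
  ext x
  simp only [mem_iUnion, mem_compl_iff, mem_ofPred_eq]
  constructor
  · rintro ⟨γ, hγ, rfl⟩
    obtain ⟨c, hc, hcs⟩ := α.exists_isTranslationChart (hγ.2.1 0)
    obtain ⟨n, hn⟩ := (tendsto_one_div_add_atTop_nhds_zero_nat.eventually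
      (hγ.2.2 c hc 0 hcs)).exists
    refine ⟨n, fun h => ?_⟩
    rw [hγ.flow_eq] at h
    rw [h, left_eq_add, sub_zero] at hn
    exact (Nat.one_div_pos_of_nat (α := ℝ)).ne' (by exact_mod_cast hn)
  · rintro ⟨n, hn⟩
    by_contra hx
    exact hn (flow_of_notMem hx _)

/-- Countably many time maps detect the domain, through their fixed-point sets. Measurability is
what lets an almost-everywhere statement pass to an image measure. -/
theorem measurableSet_flowDomain [SecondCountableTopology S] [MeasurableSpace S] [BorelSpace S]
    (hα : ∀ t, Measurable (α.flow t)) : MeasurableSet α.flowDomain := by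
  rw [flowDomain_eq_iUnion]
  exact .iUnion fun n => (measurableSet_eq_fun (hα _) measurable_id).compl

end

end HolomorphicOneForm

/-! ### Trajectories and invariant measures under coverings -/

namespace IsTranslationCover

variable {S T : Type*} [TopologicalSpace S] [ChartedSpace ℂ S]
  [TopologicalSpace T] [ChartedSpace ℂ T]
  {α : HolomorphicOneForm S} {β : HolomorphicOneForm T} {p : T → S} {d : ℕ}

theorem exists_openPartialHomeomorph (hp : IsTranslationCover β α p d) (y : T) :
    ∃ q : OpenPartialHomeomorph T S, y ∈ q.source ∧ ⇑q = p := by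
  obtain ⟨q, hy, hq⟩ := hp.isCoveringMap.isLocalHomeomorph y
  exact ⟨q, hy, hq.symm⟩

theorem isTranslationChart_trans (hp : IsTranslationCover β α p d)
    {q : OpenPartialHomeomorph T S} (hq : ⇑q = p) {c : OpenPartialHomeomorph S ℂ}
    (hc : α.IsTranslationChart c) : β.IsTranslationChart (q.trans c) :=
  hc.trans (fun y _ => hq ▸ hp.holomorphic y) (fun y _ => hq ▸ hp.pullback y)

theorem isTranslationChart_symm_trans [IsManifold 𝓘(ℂ) ω S] [IsManifold 𝓘(ℂ) ω T]
    (hp : IsTranslationCover β α p d) {q : OpenPartialHomeomorph T S} (hq : ⇑q = p)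
    {c : OpenPartialHomeomorph T ℂ} (hc : β.IsTranslationChart c) :
    α.IsTranslationChart (q.symm.trans c) := by
  have hd : ∀ y ∈ q.source, MDifferentiableAt 𝓘(ℂ) 𝓘(ℂ) q y := fun y _ => hq ▸ hp.holomorphic y
  exact hc.trans (fun x hx => q.mdifferentiableAt_symm_of_mdifferentiableAt hd hx)
    (fun x hx => HolomorphicOneForm.pullback_symm hd (fun y _ => hq ▸ hp.pullback y) hx)

/-- A chart `c` downstairs, composed with a local branch of `p`, is a translation chart upstairs,
where `γ` is known to move with unit speed. -/
theorem isTrajectory_comp (hp : IsTranslationCover β α p d) {γ : ℝ → T}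
    (hγ : β.IsTrajectory γ) : α.IsTrajectory (p ∘ γ) := by
  refine ⟨hp.isCoveringMap.continuous.comp hγ.1, fun s h0 => hγ.2.1 s ?_, fun c hc s hs => ?_⟩
  · rw [hp.pullback]
    have h0' : α.toFun (p (γ s)) = 0 := h0
    rw [h0']
    exact ContinuousLinearMap.zero_comp _
  · obtain ⟨q, hy, hq⟩ := hp.exists_openPartialHomeomorph (γ s)
    have := hγ.2.2 _ (hp.isTranslationChart_trans hq hc) s (by simpa [hy, hq] using hs)
    simpa [hq] using this

theorem flow_comp [T2Space S] [IsManifold 𝓘(ℂ) ω S] [T2Space T] [IsManifold 𝓘(ℂ) ω T]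
    (hp : IsTranslationCover β α p d) {y : T} (hy : y ∈ β.flowDomain) (t : ℝ) :
    α.flow t (p y) = p (β.flow t y) := by
  obtain ⟨γ, hγ, rfl⟩ := hy
  rw [hγ.flow_eq]
  exact (hp.isTrajectory_comp hγ).flow_eq t

theorem mem_flowDomain (hp : IsTranslationCover β α p d) {y : T} (hy : y ∈ β.flowDomain) :
    p y ∈ α.flowDomain := by
  obtain ⟨γ, hγ, rfl⟩ := hy
  exact ⟨p ∘ γ, hp.isTrajectory_comp hγ, rfl⟩

/-- Invariant measures push forward to invariant measures under translation coverings. -/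
theorem isFlowInvariant_map [T2Space S] [IsManifold 𝓘(ℂ) ω S] [T2Space T] [IsManifold 𝓘(ℂ) ω T]
    [SecondCountableTopology S] [MeasurableSpace S] [BorelSpace S]
    [MeasurableSpace T] [BorelSpace T]
    (hp : IsTranslationCover β α p d) (hα : ∀ t, Measurable (α.flow t))
    {ν : Measure T} (hν : β.IsFlowInvariant ν) : α.IsFlowInvariant (ν.map p) := by
  have hpm : Measurable p := hp.isCoveringMap.continuous.measurable
  refine ⟨?_, fun t => ⟨hα t, ?_⟩⟩
  · refine (ae_map_iff hpm.aemeasurable (HolomorphicOneForm.measurableSet_flowDomain hα)).2 ?_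
    filter_upwards [hν.1] with y hy using hp.mem_flowDomain hy
  · have hae : α.flow t ∘ p =ᵐ[ν] p ∘ β.flow t := by
      filter_upwards [hν.1] with y hy using hp.flow_comp hy t
    rw [Measure.map_map (hα t) hpm, Measure.map_congr hae,
      ← Measure.map_map hpm (hν.2 t).measurable, (hν.2 t).map_eq]

end IsTranslationCover

/-! ### Area under local isomorphisms -/

section

variable {S T : Type*} [TopologicalSpace S] [MeasurableSpace S] [BorelSpace S]
  [TopologicalSpace T] [MeasurableSpace T] [BorelSpace T]

theorem OpenPartialHomeomorph.map_symm_volume_apply (c : OpenPartialHomeomorph S ℂ)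
    {E : Set S} (hE : MeasurableSet E) :
    (volume.restrict c.target).map c.symm E = volume (c.symm ⁻¹' E ∩ c.target) := by
  rw [Measure.map_apply_of_aemeasurable
    (c.continuousOn_symm.aemeasurable c.open_target.measurableSet) hE,
    Measure.restrict_apply' c.open_target.measurableSet]

/-- Since `q.symm` is continuous only on `q.target`, measurability is proved in that subtype and
carried back along the inclusion. -/
theorem OpenPartialHomeomorph.measurableSet_preimage_symm_inter
    (q : OpenPartialHomeomorph T S) {E : Set T} (hE : MeasurableSet E) :
    MeasurableSet (q.target ∩ q.symm ⁻¹' E) := by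
  have h := q.continuousOn_symm.domRestrict.measurable hE
  have h2 := (MeasurableEmbedding.subtype_coe q.open_target.measurableSet).measurableSet_image.2 h
  convert h2 using 1
  ext x
  simp [and_comm]

end

namespace HolomorphicOneForm

section

variable {S T : Type*} [TopologicalSpace S] [ChartedSpace ℂ S] [MeasurableSpace S] [BorelSpace S]
  [TopologicalSpace T] [ChartedSpace ℂ T] [MeasurableSpace T] [BorelSpace T]
  {α : HolomorphicOneForm S} {β : HolomorphicOneForm T}

theorem IsTranslationChart.volume_le_area {c : OpenPartialHomeomorph S ℂ}
    (hc : α.IsTranslationChart c) {E : Set S} (hE : MeasurableSet E) :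
    volume (c.symm ⁻¹' E ∩ c.target) ≤ α.area E := by
  rw [← c.map_symm_volume_apply hE]
  exact le_iSup (fun c : {c : OpenPartialHomeomorph S ℂ // α.IsTranslationChart c} =>
    (volume.restrict c.1.target).map c.1.symm) ⟨c, hc⟩ E

/-- A local homeomorphism which turns translation charts into translation charts does not decrease
area. -/
theorem area_inter_source_le (q : OpenPartialHomeomorph T S)
    (hq : ∀ c, β.IsTranslationChart c → α.IsTranslationChart (q.symm.trans c))
    {E : Set T} (hE : MeasurableSet E) :
    β.area (E ∩ q.source) ≤ α.area (q.target ∩ q.symm ⁻¹' E) := by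
  have hs : MeasurableSet q.source := q.open_source.measurableSet
  have hsymm : AEMeasurable q.symm (α.area.restrict q.target) :=
    q.continuousOn_symm.aemeasurable q.open_target.measurableSet
  -- As area is a supremum, it suffices that the right side dominates every chart measure. Off
  -- `q.source` area itself does; on `q.source` the chart is transported by `q`. The first term
  -- vanishes on `E ∩ q.source`.
  have hle : β.area ≤
      β.area.restrict q.sourceᶜ + (α.area.restrict q.target).map q.symm := by
    refine iSup_le fun ⟨c, hc⟩ => Measure.le_iff.2 fun F hF => ?_
    rw [← measure_inter_add_sdiff F hs, add_comm, Measure.add_apply]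
    refine add_le_add ?_ ?_
    · rw [Measure.restrict_apply hF, ← sdiff_eq]
      exact (c.map_symm_volume_apply (hF.diff hs)).le.trans (hc.volume_le_area (hF.diff hs))
    · rw [Measure.map_apply_of_aemeasurable hsymm hF,
        Measure.restrict_apply' q.open_target.measurableSet, inter_comm,
        c.map_symm_volume_apply (hs.inter hF), inter_comm (q.symm ⁻¹' F)]
      refine le_trans (measure_mono ?_)
        ((hq c hc).volume_le_area (q.measurableSet_preimage_symm_inter hF))
      rintro z ⟨⟨hzs, hzF⟩, hzt⟩
      simp [hzs, hzt, mem_preimage.1 hzF, q.left_inv hzs, q.map_source hzs]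
  refine (hle _).trans ?_
  rw [Measure.add_apply, Measure.restrict_apply (hE.inter hs),
    Measure.map_apply_of_aemeasurable hsymm (hE.inter hs),
    Measure.restrict_apply' q.open_target.measurableSet, inter_assoc, inter_compl_self, inter_empty,
    measure_empty, zero_add]
  exact measure_mono fun x hx => ⟨hx.2, hx.1.1⟩

theorem IsTranslationChart.area_univ_ne_zero {c : OpenPartialHomeomorph S ℂ}
    (hc : α.IsTranslationChart c) {x : S} (hx : x ∈ c.source) : α.area univ ≠ 0 := by
  have h := hc.volume_le_area MeasurableSet.univ
  rw [preimage_univ, univ_inter] at h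
  exact ((c.open_target.measure_pos volume ⟨c x, c.map_source hx⟩).trans_le h).ne'

end

/-! ### Ergodicity and invariant densities -/

section

variable {S : Type*} [TopologicalSpace S] [ChartedSpace ℂ S] [MeasurableSpace S]
  {α : HolomorphicOneForm S}

theorem IsFlowInvariant.smul {μ : Measure S} (h : α.IsFlowInvariant μ) (r : ENNReal) :
    α.IsFlowInvariant (r • μ) :=
  ⟨Measure.smul_absolutelyContinuous.ae_le h.1, fun t => (h.2 t).smul_measure r⟩

/-- If the flow is ergodic, then area is, up to scaling, the only finite invariant measure that is
absolutely continuous with respect to area. -/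
theorem IsFlowErgodic.exists_eq_smul (h : α.IsFlowErgodic) [IsFiniteMeasure α.area]
    {ν : Measure S} [IsFiniteMeasure ν] (hν : α.IsFlowInvariant ν) (hac : ν ≪ α.area) :
    ∃ r : ENNReal, ν = r • α.area := by
  have hconst : ∃ r, ν.rnDeriv α.area =ᵐ[α.area] Function.const S r := by
    -- The density is invariant almost everywhere, so preimages of measurable sets under it are
    -- invariant, hence null or conull. Measurable sets separate values countably, so the density is
    -- constant.
    refine exists_eventuallyEq_const_of_forall_separating MeasurableSet fun U hU => ?_
    have hm : MeasurableSet (ν.rnDeriv α.area ⁻¹' U) := Measure.measurable_rnDeriv _ _ hU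
    have hinv : ∀ t, α.flow t ⁻¹' (ν.rnDeriv α.area ⁻¹' U) =ᵐ[α.area] ν.rnDeriv α.area ⁻¹' U :=
      fun t => (((hν.2 t).rnDeriv_comp_aeEq (h.1.2 t)).mono fun x hx => by
        rw [mem_preimage, mem_preimage, mem_preimage, ← hx, Function.comp_apply]).set_eq
    rcases h.2 _ hm hinv with h0 | h0
    · exact .inr (measure_eq_zero_iff_ae_notMem.1 h0)
    · exact .inl h0
  obtain ⟨r, hr⟩ := hconst
  refine ⟨r, ?_⟩
  rw [← Measure.withDensity_rnDeriv_eq _ _ hac, withDensity_congr_ae hr]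
  exact withDensity_const r

end

end HolomorphicOneForm

/-! ### Area under coverings -/

namespace IsTranslationCover

variable {S T : Type*} [TopologicalSpace S] [ChartedSpace ℂ S]
  [TopologicalSpace T] [ChartedSpace ℂ T]
  {α : HolomorphicOneForm S} {β : HolomorphicOneForm T} {p : T → S} {d : ℕ}

theorem surjective (hp : IsTranslationCover β α p d) (hd : d ≠ 0) : Function.Surjective p := by
  intro x
  have h : Nat.card (p ⁻¹' {x}) ≠ 0 := by rwa [hp.degree]
  obtain ⟨y, hy⟩ := (Nat.card_ne_zero.1 h).1
  exact ⟨y, hy⟩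

theorem exists_openPartialHomeomorph_cover [Nonempty T] [SecondCountableTopology T]
    (hp : IsTranslationCover β α p d) :
    ∃ q : ℕ → OpenPartialHomeomorph T S, (∀ n, ⇑(q n) = p) ∧ ⋃ n, (q n).source = univ := by
  choose q hy hq using hp.exists_openPartialHomeomorph
  obtain ⟨s, hs, hcover⟩ := TopologicalSpace.countable_cover_nhds
    fun y => (q y).open_source.mem_nhds (hy y)
  have hne : s.Nonempty := by
    obtain ⟨i, hi, -⟩ := mem_iUnion₂.1 (hcover ▸ mem_univ (Classical.arbitrary T))
    exact ⟨i, hi⟩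
  obtain ⟨u, rfl⟩ := hs.exists_eq_range hne
  exact ⟨q ∘ u, fun n => hq _, by rw [← hcover, biUnion_range]; rfl⟩

variable [MeasurableSpace S] [BorelSpace S] [MeasurableSpace T] [BorelSpace T]

/-- A measure on the total space of a covering is absolutely continuous with respect to area if
its image in the base is. -/
theorem absolutelyContinuous_area [Nonempty T] [SecondCountableTopology T]
    (hp : IsTranslationCover β α p d) {ν : Measure T} (hν : ν.map p ≪ α.area) : ν ≪ β.area := by
  obtain ⟨q, hq, hcover⟩ := hp.exists_openPartialHomeomorph_cover
  have hpm : Measurable p := hp.isCoveringMap.continuous.measurable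
  refine Measure.AbsolutelyContinuous.mk fun E hE h0 => ?_
  rw [← inter_univ E, ← hcover, inter_iUnion]
  refine measure_iUnion_null fun n => ?_
  have hEm := (q n).measurableSet_preimage_symm_inter hE
  -- The comparison is used with the roles of `α` and `β` exchanged: the image of a null set in a
  -- sheet is null.
  have hle := HolomorphicOneForm.area_inter_source_le (q n).symm (α := β) (β := α)
    (fun c hc => hp.isTranslationChart_trans (hq n) hc) hEm
  have hzero : α.area ((q n).target ∩ (q n).symm ⁻¹' E) = 0 := by
    refine measure_mono_null (fun x hx => (⟨hx, hx.1⟩ : x ∈ _ ∩ (q n).symm.source))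
      (le_antisymm (hle.trans ?_) zero_le)
    refine (measure_mono_null (fun y hy => ?_) h0).le
    have := hy.2.2
    simp only [OpenPartialHomeomorph.symm_symm, mem_preimage] at this
    rwa [(q n).left_inv hy.1] at this
  have := hν hzero
  rw [Measure.map_apply hpm hEm] at this
  -- The full preimage may meet other sheets too; only the inclusion of `E ∩ (q n).source` in it
  -- matters.
  refine measure_mono_null (fun y hy => ?_) this
  simp only [mem_preimage, ← hq n, mem_inter_iff]
  exact ⟨(q n).map_source hy.2, by rw [(q n).left_inv hy.2]; exact hy.1⟩

variable [IsManifold 𝓘(ℂ) ω S] [IsManifold 𝓘(ℂ) ω T]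

/-- A covering of degree `d` multiplies the area by at most `d`. -/
theorem area_univ_le [Nonempty T] [SecondCountableTopology T] (hp : IsTranslationCover β α p d)
    (hd : d ≠ 0) : β.area univ ≤ d * α.area univ := by
  obtain ⟨q, hq, hcover⟩ := hp.exists_openPartialHomeomorph_cover
  -- The sheets are cut down to a disjoint partition `V`, and `W n` is the image of `V n` under `p`.
  let V : ℕ → Set T := disjointed fun n => (q n).source
  have hVm : ∀ n, MeasurableSet (V n) :=
    .disjointed fun n => (q n).open_source.measurableSet
  have hVs : ∀ n, V n ⊆ (q n).source := disjointed_subset _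
  have hVd : Pairwise (Function.onFun Disjoint V) := disjoint_disjointed _
  have hVu : ⋃ n, V n = univ := (iUnion_disjointed).trans hcover
  let W : ℕ → Set S := fun n => (q n).target ∩ (q n).symm ⁻¹' V n
  have hWm : ∀ n, MeasurableSet (W n) := fun n => (q n).measurableSet_preimage_symm_inter (hVm n)
  -- Different `n` with `x ∈ W n` give different points of the fibre over `x`, because the `V n` are
  -- disjoint.
  have hcount : ∀ x : S, ∑' n, (W n).indicator (1 : S → ENNReal) x ≤ d := by
    intro x
    have hfin : (p ⁻¹' {x}).Finite := by
      -- `Nat.card` is `0` on infinite types, so `d ≠ 0` is what makes the fibre finite.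
      refine Set.finite_coe_iff.1 (Nat.finite_of_card_ne_zero ?_)
      rw [hp.degree]; exact hd
    rw [ENNReal.tsum_eq_iSup_sum]
    refine iSup_le fun s => ?_
    classical
    have hsum : ∑ n ∈ s, (W n).indicator (1 : S → ENNReal) x =
        ((s.filter fun n => x ∈ W n).card : ENNReal) := by
      rw [Finset.card_filter, Nat.cast_sum]
      refine Finset.sum_congr rfl fun n _ => ?_
      by_cases h : x ∈ W n <;> simp [h]
    rw [hsum, Nat.cast_le, ← hp.degree x, Nat.card_coe_set_eq, Set.ncard_eq_toFinset_card _ hfin]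
    refine Finset.card_le_card_of_injOn (fun n => (q n).symm x) ?_ ?_
    · intro n hn
      have hn' := (Finset.mem_filter.1 hn).2
      simp only [Finite.coe_toFinset, mem_preimage, mem_singleton_iff]
      rw [← hq n]
      exact (q n).right_inv hn'.1
    · intro n hn m hm h
      by_contra hne
      have hn' := (Finset.mem_filter.1 hn).2
      have hm' := (Finset.mem_filter.1 hm).2
      refine Set.disjoint_left.1 (hVd hne) hn'.2 ?_
      have h' : (q n).symm x = (q m).symm x := h
      rw [h']
      exact hm'.2
  calc β.area univ = ∑' n, β.area (V n) := by
        rw [← hVu, measure_iUnion hVd hVm]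
    _ ≤ ∑' n, α.area (W n) := ENNReal.tsum_le_tsum fun n => by
        have := HolomorphicOneForm.area_inter_source_le (q n)
          (fun c hc => hp.isTranslationChart_symm_trans (hq n) hc) (hVm n)
        rwa [inter_eq_left.2 (hVs n)] at this
    _ = ∫⁻ x, ∑' n, (W n).indicator (1 : S → ENNReal) x ∂α.area := by
        rw [lintegral_tsum fun n => (measurable_one.indicator (hWm n)).aemeasurable]
        simp only [lintegral_indicator_one (hWm _)]
    _ ≤ ∫⁻ _, d ∂α.area := lintegral_mono hcount
    _ = d * α.area univ := lintegral_const _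

end IsTranslationCover

/-! ### Lifting unique ergodicity -/

theorem mainTheorem6
    {S : Type*} [TopologicalSpace S] [T2Space S] [SecondCountableTopology S] [ConnectedSpace S]
    [ChartedSpace ℂ S] [IsManifold 𝓘(ℂ) ω S] [MeasurableSpace S] [BorelSpace S]
    {T : Type*} [TopologicalSpace T] [T2Space T] [SecondCountableTopology T]
    [ChartedSpace ℂ T] [IsManifold 𝓘(ℂ) ω T] [MeasurableSpace T] [BorelSpace T]
    (α : HolomorphicOneForm S) (hα : ∃ x, α.toFun x ≠ 0)
    (hS : InfiniteTopologicalType S) (harea : α.area Set.univ < ⊤)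
    (β : HolomorphicOneForm T) (p : T → S) (d : ℕ) (hd : 1 ≤ d)
    (hp : IsTranslationCover β α p d)
    (hαerg : α.IsFlowErgodic) (hβerg : β.IsFlowErgodic)
    (hαuniq : α.IsFlowUniquelyErgodic) :
    β.IsFlowUniquelyErgodic := by
  have hd0 : d ≠ 0 := Nat.one_le_iff_ne_zero.1 hd
  obtain ⟨x, hx⟩ := hα
  obtain ⟨y, rfl⟩ := hp.surjective hd0 x
  have : Nonempty T := ⟨y⟩
  obtain ⟨c, hc, hyc⟩ := α.exists_isTranslationChart hx
  obtain ⟨q, hyq, hq⟩ := hp.exists_openPartialHomeomorph y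
  have hα0 : α.area univ ≠ 0 := hc.area_univ_ne_zero hyc
  have hβ0 : β.area univ ≠ 0 :=
    (hp.isTranslationChart_trans hq hc).area_univ_ne_zero (x := y) (by simp [hyq, hq, hyc])
  have hβfin : β.area univ < ⊤ :=
    (hp.area_univ_le hd0).trans_lt (ENNReal.mul_lt_top (ENNReal.natCast_lt_top d) harea)
  have : IsFiniteMeasure α.area := ⟨harea⟩
  have : IsFiniteMeasure β.area := ⟨hβfin⟩
  have hpm : Measurable p := hp.isCoveringMap.continuous.measurable
  have hprobα : IsProbabilityMeasure ((α.area univ)⁻¹ • α.area) :=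
    ⟨by simp [ENNReal.inv_mul_cancel hα0 harea.ne]⟩
  have hprobβ : IsProbabilityMeasure ((β.area univ)⁻¹ • β.area) :=
    ⟨by simp [ENNReal.inv_mul_cancel hβ0 hβfin.ne]⟩
  refine ⟨(β.area univ)⁻¹ • β.area, ⟨hprobβ, hβerg.1.smul _⟩, ?_⟩
  rintro ν ⟨hνprob, hν⟩
  -- Normalized area is itself an invariant probability measure downstairs, hence the only one.
  have hmap : ν.map p = (α.area univ)⁻¹ • α.area :=
    hαuniq.unique ⟨Measure.isProbabilityMeasure_map hpm.aemeasurable,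
      hp.isFlowInvariant_map (fun t => (hαerg.1.2 t).measurable) hν⟩ ⟨hprobα, hαerg.1.smul _⟩
  have hac : ν ≪ β.area := hp.absolutelyContinuous_area
    (hmap ▸ Measure.smul_absolutelyContinuous)
  obtain ⟨r, hr⟩ := hβerg.exists_eq_smul hν hac
  have hr1 : r * β.area univ = 1 := by
    have := hνprob.measure_univ
    rwa [hr, Measure.smul_apply, smul_eq_mul] at this
  rw [hr, ENNReal.eq_inv_of_mul_eq_one_left hr1]
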